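/- Let $F\colon\mathbb{R}^d\to\mathbb{R}^d$ be $L$-Lipschitz, let $G\colon\mathbb{R}^d\rightrightarrows\mathbb{R}^d$ be maximally monotone, and let $0<\rho<\eta<\frac1L$ (for $L=0$ the last inequality is void). For a set-valued operator $A$ on $\mathbb{R}^d$ write $J_A=(\mathrm{Id}+A)^{-1}$. Suppose that $x^\star$ is a solution of $0\in F(x^\star)+G(x^\star)$ that satisfies the $\rho$-weak Minty variational inequality $$\langle u,x-x^\star\rangle\ge-\rho\|u\|^2\qquad\text{for all }x\in\mathbb{R}^d\text{ and }u\in F(x)+G(x).$$ Given $x_0\in\mathbb{R}^d$, put $\alpha=1-\frac{\rho}{\eta}$ and, for $k=0,1,2,\dots$, $$x_{k+1}=(1-\alpha)x_k+\alpha z^{(k)}_{N_k},\qquad N_k=\left\lceil\frac{4(1+\eta L)}{1-\eta L}\log\bigl(8(k+1)\log^2(k+2)\bigr)\right\rceil,$$ where $z^{(k)}_{N_k}$ is the result of $N_k$ steps of the forward-backward-forward method started at $z^{(k)}_0=x_k$: with $\tau=\frac{1}{2(1+\eta L)}$ and $B_k(z)=z+\eta F(z)-x_k$, $$z^{(k)}_{t+1/2}=J_{\tau\eta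 G}\bigl(z^{(k)}_t-\tau B_k(z^{(k)}_t)\bigr),\qquad z^{(k)}_{t+1}=z^{(k)}_{t+1/2}+\tau B_k(z^{(k)}_t)-\tau B_k(z^{(k)}_{t+1/2}).$$ Then $J_{\gamma G}$ (for every $\gamma>0$) and $J_{\eta(F+G)}$ are single-valued and defined on all of $\mathbb{R}^d$, and for every $K\ge1$ $$\frac1K\sum_{k=0}^{K-1}\frac1{\eta^2}\bigl\|x_k-J_{\eta(F+G)}(x_k)\bigr\|^2\le\frac{11\|x_0-x^\star\|^2}{(\eta-\rho)^2K}.$$ Moreover, every iteration $k$ (the computation of $x_{k+1}$ from $x_k$) uses at most $2N_k$ first-order oracle calls, where one call consists of one evaluation of $F$ and one evaluation of a resolvent $J_{\gamma G}$ (so that $n$ calls provide $n$ evaluations of $F$ and $n$ resolvents of $G$). -/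

import Mathlib

open scoped NNReal

namespace WeakMVI

/-! ### Set-valued operators on a real inner product space `E` -/

section Operators

variable {E : Type*} [NormedAddCommGroup E] [InnerProductSpace ℝ E]

/-- The sum `F + G` of a single-valued operator `F` and a set-valued operator `G`. -/
def addOp (F : E → E) (G : E → Set E) : E → Set E :=
  fun x => {u | ∃ g ∈ G x, u = F x + g}

/-- The multiple `γ A` of a set-valued operator `A`. -/
def smulOp (γ : ℝ) (A : E → Set E) : E → Set E :=
  fun x => {u | ∃ a ∈ A x, u = γ • a}

/-- Monotonicity: `⟨u - v, x - y⟩ ≥ 0` for all `(x, u)`, `(y, v)` in the graph. -/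
def IsMonotoneOp (A : E → Set E) : Prop :=
  ∀ x y u v : E, u ∈ A x → v ∈ A y → 0 ≤ inner ℝ (u - v) (x - y)

/-- Maximal monotonicity: the graph of `A` is not strictly contained in the graph of another
monotone operator. -/
def IsMaximalMonotoneOp (A : E → Set E) : Prop :=
  IsMonotoneOp A ∧
    ∀ B : E → Set E, IsMonotoneOp B → (∀ x, A x ⊆ B x) → ∀ x, B x ⊆ A x

/-- `xs` is a solution of the inclusion `0 ∈ A x` that satisfies the `ρ`-weak Minty
variational inequality: `⟨u, x - xs⟩ ≥ -ρ ‖u‖²` for all `(x, u)` in the graph of `A`. -/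
def IsWeakMVISolution (ρ : ℝ) (A : E → Set E) (xs : E) : Prop :=
  0 ∈ A xs ∧ ∀ x u : E, u ∈ A x → -ρ * ‖u‖ ^ 2 ≤ inner ℝ u (x - xs)

/-- The (set-valued) resolvent `(Id + A)⁻¹`: `p` is in the resolvent at `x` iff
`x ∈ p + A p`. -/
def resolventOp (A : E → Set E) : E → Set E :=
  fun x => {p | ∃ a ∈ A p, x = p + a}

/-- `A` has a resolvent that is defined everywhere and single-valued. -/
def HasSingleValuedResolvent (A : E → Set E) : Prop :=
  ∀ x : E, ∃! p : E, p ∈ resolventOp A x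

/-- The value `J_A x` of the resolvent, as a point; it is meaningful at every `x` when
`HasSingleValuedResolvent A` holds. -/
noncomputable def J (A : E → Set E) (x : E) : E :=
  Classical.epsilon fun p => p ∈ resolventOp A x

end Operators

/-! ### Algorithms with access to first-order oracles

An algorithm sees `F` only through evaluations of `F` at query points and sees `G` only through
evaluations of resolvents `J_{γ G}`. It is written as a program whose nodes are such queries,
and its cost is counted along its run. -/

/-- Programs over the space `E` with a result in `α`. -/
inductive Prog (E : Type) (α : Type) : Type
  /-- Return a result. -/
  | ret (a : α) : Prog E α
  /-- Query `F x`, and continue with the answer. -/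
  | evalF (x : E) (cont : E → Prog E α) : Prog E α
  /-- Query `J_{γ G} x`, and continue with the answer. -/
  | evalRes (γ : ℝ) (x : E) (cont : E → Prog E α) : Prog E α

namespace Prog

variable {E α β : Type}

/-- Sequential composition. -/
def bind : Prog E α → (α → Prog E β) → Prog E β
  | ret a, f => f a
  | evalF x c, f => evalF x fun v => (c v).bind f
  | evalRes γ x c, f => evalRes γ x fun v => (c v).bind f

/-- The result of a program, when `F x` is answered by `oF x` and `J_{γ G} x` by `oR γ x`. -/
def run (oF : E → E) (oR : ℝ → E → E) : Prog E α → α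
  | ret a => a
  | evalF x c => (c (oF x)).run oF oR
  | evalRes γ x c => (c (oR γ x)).run oF oR

/-- The number of evaluations of `F` during the run. -/
def countF (oF : E → E) (oR : ℝ → E → E) : Prog E α → ℕ
  | ret _ => 0
  | evalF x c => (c (oF x)).countF oF oR + 1
  | evalRes γ x c => (c (oR γ x)).countF oF oR

/-- The number of evaluations of resolvents of `G` during the run. -/
def countRes (oF : E → E) (oR : ℝ → E → E) : Prog E α → ℕ
  | ret _ => 0
  | evalF x c => (c (oF x)).countRes oF oR
  | evalRes γ x c => (c (oR γ x)).countRes oF oR + 1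

/-- The number of first-order oracle calls of the run. One call consists of one evaluation of `F`
and one evaluation of a resolvent of `G`, so the number of calls is the least `n` such that the
run makes at most `n` evaluations of `F` and at most `n` evaluations of resolvents of `G`. -/
def oracleCalls (oF : E → E) (oR : ℝ → E → E) (p : Prog E α) : ℕ :=
  max (p.countF oF oR) (p.countRes oF oR)

end Prog

section Algorithms

variable {E : Type} [NormedAddCommGroup E] [InnerProductSpace ℝ E]

/-- The forward-backward-forward method `FBF(z₀, N, A, B_in, L_B)`, with step size
`τ = 1 / (2 L_B)` and `B = B_in - z₀`. The program `bIn` evaluates `B_in`, and the program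
`resA τ` evaluates the resolvent `J_{τ A}`. -/
noncomputable def fbf (resA : ℝ → E → Prog E E) (bIn : E → Prog E E) (LB : ℝ) (z₀ : E) :
    ℕ → Prog E E
  | 0 => .ret z₀
  | t + 1 =>
    (fbf resA bIn LB z₀ t).bind fun z =>
      (bIn z).bind fun b =>
        (resA (1 / (2 * LB)) (z - (1 / (2 * LB)) • (b - z₀))).bind fun w =>
          (bIn w).bind fun b' =>
            .ret (w + (1 / (2 * LB)) • (b - z₀) - (1 / (2 * LB)) • (b' - z₀))

/-- The number of inner iterations at the outer iteration `k`:
`N_k = ⌈ 4 (1 + η L) / (1 - η L) * log (8 (k + 1) log² (k + 2)) ⌉`. -/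
noncomputable def innerIters (η L : ℝ) (k : ℕ) : ℕ :=
  ⌈4 * (1 + η * L) / (1 - η * L)
    * Real.log (8 * ((k : ℝ) + 1) * Real.log ((k : ℝ) + 2) ^ 2)⌉₊

/-- The approximate resolvent at the outer iteration `k`:
`FBF(x, N_k, η G, Id + η F, 1 + η L)`. Here `J_{τ (η G)}` is the query `J_{(τ η) G}`. -/
noncomputable def approxResolvent (η L : ℝ) (k : ℕ) (x : E) : Prog E E :=
  fbf (fun τ w => .evalRes (τ * η) w .ret) (fun z => .evalF z fun v => .ret (z + η • v))
    (1 + η * L) x (innerIters η L k)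

/-- Iteration `k` of the inexact Krasnosel'skii-Mann method, from the current iterate `x`:
with `α = 1 - ρ / η`, the next iterate is `(1 - α) x + α J̃(x)`. -/
noncomputable def kmStep (η L ρ : ℝ) (k : ℕ) (x : E) : Prog E E :=
  (approxResolvent η L k x).bind fun j => .ret ((1 - (1 - ρ / η)) • x + (1 - ρ / η) • j)

/-- The answers to the queries `J_{γ G} x`. -/
noncomputable def resOracle (G : E → Set E) (γ : ℝ) (x : E) : E := J (smulOp γ G) x

/-- The iterates `x_0, x_1, …` of the inexact Krasnosel'skii-Mann method. -/
noncomputable def kmIterate (F : E → E) (G : E → Set E) (η L ρ : ℝ) (x₀ : E) : ℕ → E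
  | 0 => x₀
  | k + 1 => (kmStep η L ρ k (kmIterate F G η L ρ x₀ k)).run F (resOracle G)

/-- The number of first-order oracle calls at iteration `k`. -/
noncomputable def kmCalls (F : E → E) (G : E → Set E) (η L ρ : ℝ) (x₀ : E) (k : ℕ) : ℕ :=
  (kmStep η L ρ k (kmIterate F G η L ρ x₀ k)).oracleCalls F (resOracle G)

end Algorithms

end WeakMVI

/-!
Put `A = F + G`. If `p` is the resolvent of `η A` at `x`, the pair `(p, (x - p) / η)` lies in the
graph of `A`, so the weak Minty inequality at this pair reads
`(1 - ρ / η) ‖x - p‖² ≤ ⟨x - p, x - x⋆⟩`: relaxed by `α = 1 - ρ / η`, the resolvent of `η A` is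
quasi-nonexpansive. The iterates are therefore quasi-Fejér as soon as the relative errors of the
approximate resolvents are summable, and the residuals telescope.

The resolvent of `η A` at `x` is the zero of the sum of the monotone operator `η G` and of the
`(1 + η L)`-Lipschitz, `(1 - η L)`-strongly monotone operator `z ↦ z + η F z - x`, to which the
forward-backward-forward method converges linearly. After `N_k` steps its squared relative error
is of order `(k + 1) ^ (-3 / 2)`.

That the resolvents of `G` exist everywhere is Minty's theorem. The points monotonically related to
one element of the graph form a ball, finitely many of these balls meet by the minimax theorem, and
all of them meet by weak compactness.
-/

namespace WeakMVI

section AdditiveOperators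

variable {E : Type*} [NormedAddCommGroup E] {A : E → Set E} {F : E → E} {x p u : E}

theorem mem_addOp : u ∈ addOp F A x ↔ u - F x ∈ A x := by
  simp only [addOp, Set.mem_ofPred_eq, eq_comm (a := u), ← eq_sub_iff_add_eq', exists_eq_right]

theorem mem_resolventOp : p ∈ resolventOp A x ↔ x - p ∈ A p := by
  simp only [resolventOp, Set.mem_ofPred_eq, eq_comm (a := x), ← eq_sub_iff_add_eq',
    exists_eq_right]

theorem mem_resolventOp_addOp : p ∈ resolventOp (addOp F A) x ↔ p ∈ resolventOp A (x - F p) := by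
  rw [mem_resolventOp, mem_addOp, mem_resolventOp, sub_right_comm]

theorem HasSingleValuedResolvent.J_mem (hA : HasSingleValuedResolvent A) (x : E) :
    J A x ∈ resolventOp A x :=
  Classical.epsilon_spec (hA x).exists

theorem HasSingleValuedResolvent.mem_resolventOp_iff (hA : HasSingleValuedResolvent A) :
    p ∈ resolventOp A x ↔ J A x = p :=
  ⟨fun hp => (hA x).unique (hA.J_mem x) hp, fun h => h ▸ hA.J_mem x⟩

end AdditiveOperators

section MonotoneOperators

variable {E : Type*} [NormedAddCommGroup E] [InnerProductSpace ℝ E] {A : E → Set E}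

theorem smulOp_addOp (γ : ℝ) (F : E → E) :
    smulOp γ (addOp F A) = addOp (γ • F) (smulOp γ A) := by
  ext x u
  constructor
  · rintro ⟨_, ⟨g, hg, rfl⟩, rfl⟩
    exact ⟨γ • g, ⟨g, hg, rfl⟩, smul_add γ _ _⟩
  · rintro ⟨_, ⟨g, hg, rfl⟩, rfl⟩
    exact ⟨F x + g, ⟨g, hg, rfl⟩, (smul_add γ _ _).symm⟩

theorem smulOp_smulOp (γ δ : ℝ) : smulOp γ (smulOp δ A) = smulOp (γ * δ) A := by
  ext x u
  constructor
  · rintro ⟨_, ⟨a, ha, rfl⟩, rfl⟩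
    exact ⟨a, ha, smul_smul γ δ a⟩
  · rintro ⟨a, ha, rfl⟩
    exact ⟨δ • a, ⟨a, ha, rfl⟩, (smul_smul γ δ a).symm⟩

theorem mem_smulOp {γ : ℝ} (hγ : γ ≠ 0) {x u : E} : u ∈ smulOp γ A x ↔ γ⁻¹ • u ∈ A x := by
  simp only [smulOp, Set.mem_ofPred_eq, eq_comm (a := u), ← eq_inv_smul_iff₀ hγ, exists_eq_right]

theorem IsMonotoneOp.smul (hA : IsMonotoneOp A) {γ : ℝ} (hγ : 0 ≤ γ) :
    IsMonotoneOp (smulOp γ A) := by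
  rintro x y _ _ ⟨a, ha, rfl⟩ ⟨b, hb, rfl⟩
  rw [← smul_sub, real_inner_smul_left]
  exact mul_nonneg hγ (hA x y a b ha hb)

theorem IsMaximalMonotoneOp.smul (hA : IsMaximalMonotoneOp A) {γ : ℝ} (hγ : 0 < γ) :
    IsMaximalMonotoneOp (smulOp γ A) := by
  refine ⟨hA.1.smul hγ.le, fun B hB hAB x u hu => ?_⟩
  rw [mem_smulOp hγ.ne']
  refine hA.2 (smulOp γ⁻¹ B) (hB.smul (inv_nonneg.2 hγ.le)) (fun y a ha => ?_) x ⟨u, hu, rfl⟩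
  exact ⟨γ • a, hAB y ⟨a, ha, rfl⟩, (inv_smul_smul₀ hγ.ne' a).symm⟩

theorem IsMaximalMonotoneOp.mem_of_forall_inner_nonneg (hA : IsMaximalMonotoneOp A) {x u : E}
    (h : ∀ y v, v ∈ A y → 0 ≤ inner ℝ (u - v) (x - y)) : u ∈ A x := by
  refine hA.2 (fun y => {v | v ∈ A y ∨ (y = x ∧ v = u)}) ?_ (fun y v hv => Or.inl hv) x
    (Or.inr ⟨rfl, rfl⟩)
  rintro y z v w (hv | ⟨rfl, rfl⟩) (hw | ⟨rfl, rfl⟩)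
  · exact hA.1 y z v w hv hw
  · rw [← neg_sub w, ← neg_sub z, inner_neg_neg]
    exact h y v hv
  · exact h z w hw
  · rw [sub_self, inner_zero_left]

theorem IsMonotoneOp.norm_sub_le_of_mem_resolventOp (hA : IsMonotoneOp A) {x y p q : E}
    (hp : p ∈ resolventOp A x) (hq : q ∈ resolventOp A y) : ‖p - q‖ ≤ ‖x - y‖ := by
  have hmono := hA p q _ _ (mem_resolventOp.1 hp) (mem_resolventOp.1 hq)
  have hfirm : ‖p - q‖ ^ 2 ≤ inner ℝ (x - y) (p - q) := by
    rw [sub_sub_sub_comm, inner_sub_left, real_inner_self_eq_norm_sq] at hmono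
    linarith
  nlinarith [real_inner_le_norm (x - y) (p - q), norm_nonneg (p - q), norm_nonneg (x - y)]

theorem IsMonotoneOp.lipschitzWith_J (hA : IsMonotoneOp A) (hJ : HasSingleValuedResolvent A) :
    LipschitzWith 1 (J A) :=
  LipschitzWith.mk_one fun x y => by
    simpa only [dist_eq_norm] using
      hA.norm_sub_le_of_mem_resolventOp (hJ.J_mem x) (hJ.J_mem y)

theorem lipschitzWith_mul_smul {E : Type*} [SeminormedAddCommGroup E] [NormedSpace ℝ E]
    {F : E → E} {K : ℝ≥0} (hF : LipschitzWith K F) {c : ℝ≥0} :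
    LipschitzWith (c * K) ((c : ℝ) • F) := by
  have hcomp := (lipschitzWith_smul (β := E) (c : ℝ)).comp hF
  rw [NNReal.nnnorm_eq] at hcomp
  exact hcomp

theorem hasSingleValuedResolvent_addOp [CompleteSpace E] (hA : IsMonotoneOp A)
    (hJ : HasSingleValuedResolvent A) {F : E → E} {K : ℝ≥0} (hF : LipschitzWith K F)
    (hK : K < 1) : HasSingleValuedResolvent (addOp F A) := by
  intro x
  have hT : ContractingWith K fun p => J A (x - F p) :=
    ⟨hK, by
      simpa [Function.comp_def] using
        (hA.lipschitzWith_J hJ).comp ((LipschitzWith.const x).sub hF)⟩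
  have hfix (p : E) : p ∈ resolventOp (addOp F A) x ↔ J A (x - F p) = p := by
    rw [mem_resolventOp_addOp, hJ.mem_resolventOp_iff]
  exact ⟨_, (hfix _).2 hT.fixedPoint_isFixedPt, fun q hq => hT.fixedPoint_unique ((hfix q).1 hq)⟩

end MonotoneOperators

section Minty

variable {E : Type*} [NormedAddCommGroup E] [InnerProductSpace ℝ E]

theorem inner_sum_smul_le_sum_mul_inner {ι : Type*} [Fintype ι] {x v : ι → E}
    (hmono : ∀ i j, 0 ≤ inner ℝ (v i - v j) (x i - x j)) {w : ι → ℝ}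
    (hw : w ∈ stdSimplex ℝ ι) :
    inner ℝ (∑ i, w i • v i) (∑ i, w i • x i) ≤ ∑ i, w i * inner ℝ (v i) (x i) := by
  have hpairs : 0 ≤ ∑ i, ∑ j, w i * w j * inner ℝ (v i - v j) (x i - x j) :=
    Finset.sum_nonneg fun i _ => Finset.sum_nonneg fun j _ =>
      mul_nonneg (mul_nonneg (hw.1 i) (hw.1 j)) (hmono i j)
  have hexpand (i j : ι) : w i * w j * inner ℝ (v i - v j) (x i - x j)
      = w j * (w i * inner ℝ (v i) (x i)) + w i * (w j * inner ℝ (v j) (x j))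
        - inner ℝ (w i • v i) (w j • x j) - inner ℝ (w j • v j) (w i • x i) := by
    simp only [inner_sub_left, inner_sub_right, real_inner_smul_left, real_inner_smul_right]
    ring
  simp only [hexpand, Finset.sum_sub_distrib, Finset.sum_add_distrib, ← Finset.mul_sum,
    ← Finset.sum_mul, hw.2, ← inner_sum, ← sum_inner] at hpairs
  linarith

theorem inner_sub_sub_eq_dist_midpoint_sq_sub (a b p : E) :
    inner ℝ (p - a) (p - b) = dist p (midpoint ℝ a b) ^ 2 - (dist a b / 2) ^ 2 := by
  have hsub : p - b = (p - a) - (b - a) := by abel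
  have hmid : p - midpoint ℝ a b = (p - a) - (2⁻¹ : ℝ) • (b - a) := by
    rw [midpoint_eq_smul_add, invOf_eq_inv]
    module
  rw [dist_comm a b, dist_eq_norm, dist_eq_norm, hmid, hsub, norm_sub_sq_real, inner_sub_right,
    real_inner_smul_right, norm_smul, Real.norm_of_nonneg (by norm_num : (0 : ℝ) ≤ 2⁻¹),
    real_inner_self_eq_norm_sq]
  ring

theorem inner_sub_sub_nonpos_iff_mem_closedBall {a b p : E} :
    inner ℝ (p - a) (p - b) ≤ 0 ↔ p ∈ Metric.closedBall (midpoint ℝ a b) (dist a b / 2) := by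
  rw [inner_sub_sub_eq_dist_midpoint_sq_sub, sub_nonpos, Metric.mem_closedBall,
    sq_le_sq₀ dist_nonneg (by positivity)]

theorem convexOn_inner_sub_sub (a b : E) :
    ConvexOn ℝ Set.univ fun p => inner ℝ (p - a) (p - b) := by
  simp only [inner_sub_sub_eq_dist_midpoint_sq_sub, sub_eq_add_neg _ ((_ : ℝ) ^ 2)]
  exact ((convexOn_univ_dist _).pow (fun _ _ => dist_nonneg) 2).add_const _

theorem sum_mul_inner_sub_sub_nonpos {ι : Type*} [Fintype ι] {x v : ι → E}
    (hmono : ∀ i j, 0 ≤ inner ℝ (v i - v j) (x i - x j)) {w : ι → ℝ}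
    (hw : w ∈ stdSimplex ℝ ι) (y : E) :
    ∑ i, w i * inner ℝ (∑ j, w j • x j - x i) (∑ j, w j • x j - (y - v i)) ≤ 0 := by
  set q := ∑ j, w j • x j with hq
  have hexpand (i : ι) : w i * inner ℝ (q - x i) (q - (y - v i))
      = w i * inner ℝ q (q - y) - inner ℝ (w i • x i) (q - y)
        + inner ℝ (w i • v i) q - w i * inner ℝ (v i) (x i) := by
    simp only [inner_sub_left, inner_sub_right, real_inner_smul_left,
      real_inner_comm (x i) (v i), real_inner_comm q (v i)]
    ring
  simp only [hexpand, Finset.sum_sub_distrib, Finset.sum_add_distrib, ← Finset.sum_mul, hw.2,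
    ← sum_inner, ← hq]
  linarith [inner_sum_smul_le_sum_mul_inner hmono hw]

/-- The **Debrunner-Flor lemma**. -/
theorem exists_mem_convexHull_forall_inner_nonpos {ι : Type*} [Finite ι] [Nonempty ι]
    {x v : ι → E} (hmono : ∀ i j, 0 ≤ inner ℝ (v i - v j) (x i - x j)) (y : E) :
    ∃ p ∈ convexHull ℝ (Set.range x), ∀ i, inner ℝ (p - x i) (p - (y - v i)) ≤ 0 := by
  classical
  have := Fintype.ofFinite ι
  let f (q : E) (w : ι → ℝ) : ℝ := ∑ i, w i * inner ℝ (q - x i) (q - (y - v i))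
  have hX : Convex ℝ (convexHull ℝ (Set.range x)) := convex_convexHull ℝ _
  have hY : Convex ℝ (stdSimplex ℝ ι) := convex_stdSimplex ℝ ι
  have hconvex (w) (hw : w ∈ stdSimplex ℝ ι) :
      ConvexOn ℝ (convexHull ℝ (Set.range x)) (f · w) := by
    simp only [f, ← Finset.sum_fn]
    exact Finset.sum_induction _ _ (fun _ _ => ConvexOn.add) (convexOn_const (0 : ℝ) hX)
      fun i _ => ((convexOn_inner_sub_sub _ _).subset (Set.subset_univ _) hX).smul (hw.1 i)
  have hconcave (q) : ConcaveOn ℝ (stdSimplex ℝ ι) (f q) :=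
    (Fintype.linearCombination ℝ fun i => inner ℝ (q - x i) (q - (y - v i))).concaveOn hY
  obtain ⟨p, hp, w, hw, hsaddle⟩ := Sion.exists_isSaddlePointOn (f := f)
    (Set.range_nonempty x).convexHull hX ((Set.finite_range x).isCompact_convexHull ℝ)
    (fun w _ => Continuous.continuousOn (by fun_prop) |>.lowerSemicontinuousOn)
    (fun w hw => (hconvex w hw).quasiconvexOn)
    hY ⟨_, single_mem_stdSimplex ℝ (Classical.arbitrary ι)⟩ (isCompact_stdSimplex ℝ ι)
    (fun q _ => Continuous.continuousOn (by fun_prop) |>.upperSemicontinuousOn)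
    (fun q _ => (hconcave q).quasiconcaveOn)
  -- Against the strategy `w`, the point `∑ i, w i • x i` keeps the payoff nonpositive.
  have hmean : ∑ i, w i • x i ∈ convexHull ℝ (Set.range x) :=
    mem_convexHull_of_exists_fintype w x hw.1 hw.2 (Set.mem_range_self ·) rfl
  refine ⟨p, hp, fun i => ?_⟩
  have hpure : f p (Pi.single i 1) = inner ℝ (p - x i) (p - (y - v i)) := by
    simp [f, Pi.single_apply]
  rw [← hpure]
  exact (hsaddle _ hmean _ (single_mem_stdSimplex ℝ i)).trans
    (sum_mul_inner_sub_sub_nonpos hmono hw y)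

theorem nonempty_iInter_closedBall [CompleteSpace E] {ι : Type*} {c : ι → E} {r : ι → ℝ}
    (h : ∀ s : Finset ι, (⋂ i ∈ s, Metric.closedBall (c i) (r i)).Nonempty) :
    (⋂ i, Metric.closedBall (c i) (r i)).Nonempty := by
  classical
  rcases isEmpty_or_nonempty ι with _ | ⟨⟨i₀⟩⟩
  · exact ⟨0, by simp⟩
  let T (i : ι) : Set (WeakDual ℝ E) := WeakDual.toStrongDual ⁻¹'
    Metric.closedBall (InnerProductSpace.toDual ℝ E (c i)) (r i)
  have hcompact : IsCompact (T i₀) := WeakDual.isCompact_closedBall _ _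
  have hclosed (i : ι) : IsClosed (T i) := WeakDual.isClosed_closedBall _ _
  have hmem (p : E) (i : ι) : StrongDual.toWeakDual (InnerProductSpace.toDual ℝ E p) ∈ T i ↔
      p ∈ Metric.closedBall (c i) (r i) := by
    simp [T]
  obtain ⟨φ, -, hφ⟩ := hcompact.inter_iInter_nonempty T hclosed fun s => by
    obtain ⟨p, hp⟩ := h (insert i₀ s)
    rw [← Finset.set_biInter_insert]
    exact ⟨_, Set.mem_iInter₂.2 fun i hi => (hmem p i).2 (Set.mem_iInter₂.1 hp i hi)⟩
  obtain ⟨p, rfl⟩ : ∃ p, StrongDual.toWeakDual (InnerProductSpace.toDual ℝ E p) = φ :=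
    ⟨(InnerProductSpace.toDual ℝ E).symm (WeakDual.toStrongDual φ), by simp⟩
  exact ⟨p, Set.mem_iInter.2 fun i => (hmem p i).1 (Set.mem_iInter.1 hφ i)⟩

/-- **Minty's theorem**. -/
theorem IsMaximalMonotoneOp.resolventOp_nonempty [CompleteSpace E] {A : E → Set E}
    (hA : IsMaximalMonotoneOp A) (y : E) : (resolventOp A y).Nonempty := by
  let Γ := {z : E × E // z.2 ∈ A z.1}
  obtain ⟨p, hp⟩ : (⋂ z : Γ, Metric.closedBall (midpoint ℝ z.1.1 (y - z.1.2))
      (dist z.1.1 (y - z.1.2) / 2)).Nonempty := by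
    refine nonempty_iInter_closedBall fun s => ?_
    rcases s.eq_empty_or_nonempty with rfl | hs
    · exact ⟨0, by simp⟩
    have := hs.to_subtype
    obtain ⟨p, -, hp⟩ := exists_mem_convexHull_forall_inner_nonpos
      (fun i j : s => hA.1 _ _ _ _ i.1.2 j.1.2) y
    exact ⟨p, Set.mem_iInter₂.2 fun z hz =>
      inner_sub_sub_nonpos_iff_mem_closedBall.1 (hp ⟨z, hz⟩)⟩
  refine ⟨p, mem_resolventOp.2 (hA.mem_of_forall_inner_nonneg fun x u hu => ?_)⟩
  have hxu := inner_sub_sub_nonpos_iff_mem_closedBall.2 (Set.mem_iInter.1 hp ⟨(x, u), hu⟩)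
  rw [real_inner_comm, ← neg_nonneg, ← inner_neg_left] at hxu
  convert hxu using 2
  abel

theorem IsMaximalMonotoneOp.hasSingleValuedResolvent [CompleteSpace E] {A : E → Set E}
    (hA : IsMaximalMonotoneOp A) : HasSingleValuedResolvent A := by
  intro x
  obtain ⟨p, hp⟩ := hA.resolventOp_nonempty x
  refine ⟨p, hp, fun q hq => sub_eq_zero.1 (norm_le_zero_iff.1 ?_)⟩
  simpa only [sub_self, norm_zero] using hA.1.norm_sub_le_of_mem_resolventOp hq hp

theorem IsMaximalMonotoneOp.hasSingleValuedResolvent_smulOp_addOp [CompleteSpace E]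
    {A : E → Set E} (hA : IsMaximalMonotoneOp A) {F : E → E} {K : ℝ≥0} (hF : LipschitzWith K F)
    {γ : ℝ} (hγ : 0 < γ) (hγK : γ * K < 1) :
    HasSingleValuedResolvent (smulOp γ (addOp F A)) := by
  lift γ to ℝ≥0 using hγ.le
  rw [smulOp_addOp]
  exact hasSingleValuedResolvent_addOp (hA.1.smul hγ.le) (hA.smul hγ).hasSingleValuedResolvent
    (lipschitzWith_mul_smul hF) (mod_cast hγK)

end Minty

namespace Prog

variable {E α β : Type} (oF : E → E) (oR : ℝ → E → E)

theorem run_bind (p : Prog E α) (f : α → Prog E β) :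
    (p.bind f).run oF oR = (f (p.run oF oR)).run oF oR := by
  induction p with
  | ret a => rfl
  | evalF _ _ ih => exact ih _
  | evalRes _ _ _ ih => exact ih _

theorem countF_bind (p : Prog E α) (f : α → Prog E β) :
    (p.bind f).countF oF oR = p.countF oF oR + (f (p.run oF oR)).countF oF oR := by
  induction p with
  | ret a => simp only [bind, countF, run, zero_add]
  | evalF x c ih => simp only [bind, countF, run, ih, add_right_comm]
  | evalRes γ x c ih => simp only [bind, countF, run, ih]

theorem countRes_bind (p : Prog E α) (f : α → Prog E β) :
    (p.bind f).countRes oF oR = p.countRes oF oR + (f (p.run oF oR)).countRes oF oR := by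
  induction p with
  | ret a => simp only [bind, countRes, run, zero_add]
  | evalF x c ih => simp only [bind, countRes, run, ih]
  | evalRes γ x c ih => simp only [bind, countRes, run, ih, add_right_comm]

end Prog

/-- One step of the forward-backward-forward method with step size `τ` for the inclusion
`0 ∈ B z + A z`, where `R` is the resolvent of `τ A`. -/
def fbfStep {E : Type*} [AddCommGroup E] [Module ℝ E] (R B : E → E) (τ : ℝ) (z : E) : E :=
  R (z - τ • B z) + τ • B z - τ • B (R (z - τ • B z))

section Programs

variable {E : Type} [NormedAddCommGroup E] [InnerProductSpace ℝ E]
  (oF : E → E) (oR : ℝ → E → E)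

theorem run_fbf (resA : ℝ → E → Prog E E) (bIn : E → Prog E E) (LB : ℝ) (z₀ : E) (N : ℕ) :
    (fbf resA bIn LB z₀ N).run oF oR =
      (fbfStep (fun v => (resA (1 / (2 * LB)) v).run oF oR) (fun z => (bIn z).run oF oR - z₀)
        (1 / (2 * LB)))^[N] z₀ := by
  induction N with
  | zero => rfl
  | succ N ih =>
    simp only [fbf, Prog.run_bind, Prog.run, ih, Function.iterate_succ_apply', fbfStep]

variable {resA : ℝ → E → Prog E E} {bIn : E → Prog E E} {a b : ℕ}

theorem countF_fbf (hres : ∀ τ v, (resA τ v).countF oF oR = a)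
    (hb : ∀ z, (bIn z).countF oF oR = b) (LB : ℝ) (z₀ : E) (N : ℕ) :
    (fbf resA bIn LB z₀ N).countF oF oR = (2 * b + a) * N := by
  induction N with
  | zero => rfl
  | succ N ih =>
    simp only [fbf, Prog.countF_bind, Prog.countF, hres, hb, ih]
    ring

theorem countRes_fbf (hres : ∀ τ v, (resA τ v).countRes oF oR = a)
    (hb : ∀ z, (bIn z).countRes oF oR = b) (LB : ℝ) (z₀ : E) (N : ℕ) :
    (fbf resA bIn LB z₀ N).countRes oF oR = (2 * b + a) * N := by
  induction N with
  | zero => rfl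
  | succ N ih =>
    simp only [fbf, Prog.countRes_bind, Prog.countRes, hres, hb, ih]
    ring

theorem run_approxResolvent (η L : ℝ) (k : ℕ) (x : E) :
    (approxResolvent η L k x).run oF oR =
      (fbfStep (oR (1 / (2 * (1 + η * L)) * η)) (fun z => z + (η • oF) z - x)
        (1 / (2 * (1 + η * L))))^[innerIters η L k] x :=
  run_fbf oF oR _ _ _ _ _

theorem oracleCalls_kmStep (η L ρ : ℝ) (k : ℕ) (x : E) :
    (kmStep η L ρ k x).oracleCalls oF oR = 2 * innerIters η L k := by
  have hF : (approxResolvent η L k x).countF oF oR = 2 * innerIters η L k :=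
    countF_fbf oF oR (a := 0) (b := 1) (fun _ _ => rfl) (fun _ => rfl) _ _ _
  have hRes : (approxResolvent η L k x).countRes oF oR = innerIters η L k :=
    (countRes_fbf oF oR (a := 1) (b := 0) (fun _ _ => rfl) (fun _ => rfl) _ _ _).trans
      (one_mul _)
  simp only [Prog.oracleCalls, kmStep, Prog.countF_bind, Prog.countRes_bind, Prog.countF,
    Prog.countRes, hF, hRes, add_zero]
  omega

end Programs

section ForwardBackwardForward

variable {E : Type*} [NormedAddCommGroup E] [InnerProductSpace ℝ E] {A : E → Set E}

theorem norm_add_sq_le_of_le_inner_sub {p q r : E} {θ : ℝ} (hθ : 0 ≤ θ) (hθ' : θ ≤ 1 / 2)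
    (hr : ‖r‖ ≤ 1 / 2 * ‖q‖) (h : θ * ‖p‖ ^ 2 ≤ inner ℝ (q - r) p) :
    ‖p + r‖ ^ 2 ≤ (1 - 3 / 4 * θ) * ‖p + q‖ ^ 2 := by
  have hsplit : ‖p + r‖ ^ 2 = ‖p + q‖ ^ 2 - ‖q‖ ^ 2 + ‖r‖ ^ 2 - 2 * inner ℝ (q - r) p := by
    rw [norm_add_sq_real, norm_add_sq_real, inner_sub_left, real_inner_comm p q,
      real_inner_comm p r]
    ring
  have hr_sq : ‖r‖ ^ 2 ≤ (1 / 2 * ‖q‖) ^ 2 := by gcongr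
  have hpq : ‖p + q‖ ^ 2 ≤ 2 * (‖p‖ ^ 2 + ‖q‖ ^ 2) :=
    (pow_le_pow_left₀ (norm_nonneg _) (norm_add_le p q) 2).trans add_sq_le
  nlinarith [mul_le_mul_of_nonneg_left hpq hθ, mul_le_mul_of_nonneg_right hθ' (sq_nonneg ‖q‖),
    mul_nonneg hθ (sq_nonneg ‖p‖)]

theorem norm_fbfStep_sub_sq_le (hA : IsMonotoneOp A) {R B : E → E} {K : ℝ≥0} {τ μ : ℝ}
    (hτ : 0 ≤ τ) (hR : ∀ v, R v ∈ resolventOp (smulOp τ A) v) (hB : LipschitzWith K B)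
    (hBμ : ∀ x y, μ * ‖x - y‖ ^ 2 ≤ inner ℝ (B x - B y) (x - y)) (hτK : τ * K ≤ 1 / 2)
    (hμ : 0 ≤ μ) (hτμ : τ * μ ≤ 1 / 2) {zs : E} (hzs : -B zs ∈ A zs) (z : E) :
    ‖fbfStep R B τ z - zs‖ ^ 2 ≤ (1 - 3 / 4 * (τ * μ)) * ‖z - zs‖ ^ 2 := by
  set w := R (z - τ • B z) with hw
  have hmono : 0 ≤ inner ℝ (z - τ • B z - w - τ • -B zs) (w - zs) :=
    hA.smul hτ w zs _ _ (mem_resolventOp.1 (hR _)) ⟨_, hzs, rfl⟩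
  have hforward : ‖τ • (B z - B w)‖ ≤ 1 / 2 * ‖z - w‖ := by
    rw [norm_smul, Real.norm_of_nonneg hτ]
    calc τ * ‖B z - B w‖ ≤ τ * (K * ‖z - w‖) := by gcongr; exact hB.norm_sub_le z w
      _ ≤ 1 / 2 * ‖z - w‖ := by rw [← mul_assoc]; gcongr
  have hinner : τ * μ * ‖w - zs‖ ^ 2 ≤ inner ℝ ((z - w) - τ • (B z - B w)) (w - zs) :=
    calc τ * μ * ‖w - zs‖ ^ 2 ≤ τ * inner ℝ (B w - B zs) (w - zs) := by
          rw [mul_assoc]; gcongr; exact hBμ w zs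
      _ ≤ inner ℝ (z - τ • B z - w - τ • -B zs) (w - zs)
            + τ * inner ℝ (B w - B zs) (w - zs) := le_add_of_nonneg_left hmono
      _ = inner ℝ ((z - w) - τ • (B z - B w)) (w - zs) := by
          rw [← real_inner_smul_left, ← inner_add_left]
          congr 1
          module
  convert norm_add_sq_le_of_le_inner_sub (mul_nonneg hτ hμ) hτμ hforward hinner using 3
  · rw [fbfStep, ← hw]
    module
  · rw [sub_add_sub_cancel']

theorem one_sub_mul_norm_sub_sq_le_inner {C : E → E} {K : ℝ≥0} (hC : LipschitzWith K C)
    (y z : E) : (1 - K) * ‖y - z‖ ^ 2 ≤ inner ℝ (y + C y - (z + C z)) (y - z) := by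
  have hCS : -(‖C y - C z‖ * ‖y - z‖) ≤ inner ℝ (C y - C z) (y - z) :=
    neg_le_of_abs_le (abs_real_inner_le_norm _ _)
  rw [add_sub_add_comm, inner_add_left, real_inner_self_eq_norm_sq]
  nlinarith [mul_le_mul_of_nonneg_right (hC.norm_sub_le y z) (norm_nonneg (y - z))]

theorem norm_iterate_fbfStep_sub_sq_le (hA : IsMonotoneOp A) {R C : E → E} {K : ℝ≥0}
    (hC : LipschitzWith K C) (hK : K ≤ 1)
    (hR : ∀ v, R v ∈ resolventOp (smulOp (1 / (2 * (1 + K))) A) v) {x p : E}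
    (hp : p ∈ resolventOp (addOp C A) x) (z : E) (N : ℕ) :
    ‖(fbfStep R (fun z => z + C z - x) (1 / (2 * (1 + K))))^[N] z - p‖ ^ 2
      ≤ (1 - 3 / 8 * ((1 - K) / (1 + K))) ^ N * ‖z - p‖ ^ 2 := by
  have : (K : ℝ) ≤ 1 := mod_cast hK
  have hfactor : 1 - 3 / 4 * (1 / (2 * (1 + K)) * (1 - K))
      = 1 - 3 / 8 * ((1 - K) / (1 + K) : ℝ) := by
    field_simp
    ring
  have hratio : 1 / (2 * (1 + K)) * (1 - K) ≤ (1 / 2 : ℝ) := by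
    rw [one_div_mul_eq_div, div_le_div_iff₀ (by positivity) two_pos]
    linarith [K.coe_nonneg]
  have hB : LipschitzWith (1 + K) fun z => z + C z - x := by
    simpa using (LipschitzWith.id.add hC).sub (LipschitzWith.const x)
  have hzero : -(p + C p - x) ∈ A p := by
    rwa [neg_sub, ← sub_sub, ← mem_addOp, ← mem_resolventOp]
  have hstep := norm_fbfStep_sub_sq_le hA (μ := 1 - K) (by positivity) hR hB
    (fun y z => by simpa only [sub_sub_sub_cancel_right] using
      one_sub_mul_norm_sub_sq_le_inner hC y z)
    (by push_cast; field_simp; rfl) (by linarith) hratio hzero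
  rw [hfactor] at hstep
  induction N with
  | zero => simp
  | succ N ih =>
    rw [Function.iterate_succ_apply', pow_succ' _ N, mul_assoc]
    exact (hstep _).trans (mul_le_mul_of_nonneg_left ih (by linarith))

end ForwardBackwardForward

section Accuracy

theorem one_sub_pow_le_inv_pow {θ b : ℝ} {m N : ℕ} (hθ : θ ≤ 1) (hb : 0 < b)
    (h : m * Real.log b ≤ N * θ) : (1 - θ) ^ N ≤ (b ^ m)⁻¹ :=
  calc (1 - θ) ^ N ≤ Real.exp (-θ) ^ N :=
        pow_le_pow_left₀ (sub_nonneg.2 hθ) (Real.one_sub_le_exp_neg θ) N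
    _ = Real.exp (-(N * θ)) := by rw [← Real.exp_nat_mul, mul_neg]
    _ ≤ Real.exp (-(m * Real.log b)) := Real.exp_le_exp.2 (neg_le_neg h)
    _ = (b ^ m)⁻¹ := by rw [Real.exp_neg, Real.exp_nat_mul, Real.exp_log hb]

-- The constant `1.9` is `√8 log 2 = 1.96…` rounded down.
theorem sq_le_eight_mul_add_one_mul_log_sq (k : ℕ) :
    (1.9 * √((k : ℝ) + 1)) ^ 2 ≤ 8 * ((k : ℝ) + 1) * Real.log ((k : ℝ) + 2) ^ 2 := by
  have hlog : 0.69 ≤ Real.log ((k : ℝ) + 2) :=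
    (by linarith [Real.log_two_gt_d9] : (0.69 : ℝ) ≤ Real.log 2).trans
      (Real.log_le_log two_pos (by linarith [k.cast_nonneg (α := ℝ)]))
  calc (1.9 * √((k : ℝ) + 1)) ^ 2 = 1.9 ^ 2 * ((k : ℝ) + 1) := by
        rw [mul_pow, Real.sq_sqrt (by positivity)]
    _ ≤ 8 * ((k : ℝ) + 1) * 0.69 ^ 2 := by linarith [k.cast_nonneg (α := ℝ)]
    _ ≤ 8 * ((k : ℝ) + 1) * Real.log ((k : ℝ) + 2) ^ 2 := by gcongr

theorem one_sub_pow_innerIters_le {η L : ℝ} (hηL : 0 ≤ η * L) (hηL' : η * L < 1) (k : ℕ) :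
    (1 - 3 / 8 * ((1 - η * L) / (1 + η * L))) ^ innerIters η L k
      ≤ (6 * √((k : ℝ) + 1) ^ 3)⁻¹ := by
  set κ := (1 - η * L) / (1 + η * L) with hκ
  have hκ_pos : 0 < κ := div_pos (by linarith) (by linarith)
  have hκ_le : κ ≤ 1 := (div_le_one (by linarith)).2 (by linarith)
  set c := 8 * ((k : ℝ) + 1) * Real.log ((k : ℝ) + 2) ^ 2
  set b := 1.9 * √((k : ℝ) + 1) with hb
  have hb_pos : 0 < b := by positivity
  have hlog : 2 * Real.log b ≤ Real.log c := by
    simpa only [Real.log_pow, Nat.cast_ofNat] using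
      Real.log_le_log (by positivity) (sq_le_eight_mul_add_one_mul_log_sq k)
  have hN : 4 * Real.log c ≤ innerIters η L k * κ := by
    rw [← div_le_iff₀ hκ_pos, hκ, ← div_mul_eq_mul_div, div_div_eq_mul_div]
    exact Nat.le_ceil _
  calc (1 - 3 / 8 * κ) ^ innerIters η L k ≤ (b ^ 3)⁻¹ :=
        one_sub_pow_le_inv_pow (by linarith) hb_pos (by push_cast; linarith)
    _ ≤ (6 * √((k : ℝ) + 1) ^ 3)⁻¹ := by
        rw [hb, mul_pow]
        gcongr
        norm_num

theorem inv_sqrt_add_one_pow_three_le {x : ℝ} (hx : 0 < x) :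
    (√(x + 1) ^ 3)⁻¹ ≤ 2 / √x - 2 / √(x + 1) := by
  set a := √x
  set b := √(x + 1)
  have ha : 0 < a := Real.sqrt_pos.2 hx
  have hab : a ≤ b := Real.sqrt_le_sqrt (by linarith)
  have hb : 0 < b := ha.trans_le hab
  have hsq : (b - a) * (b + a) = 1 := by
    rw [mul_comm, ← sq_sub_sq, Real.sq_sqrt (by positivity), Real.sq_sqrt hx.le,
      add_sub_cancel_left]
  have hgap : 1 ≤ 2 * b * (b - a) := by nlinarith
  rw [div_sub_div _ _ ha.ne' hb.ne', inv_eq_one_div,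
    div_le_div_iff₀ (by positivity) (by positivity)]
  calc 1 * (a * b) ≤ b ^ 2 * 1 := by nlinarith
    _ ≤ b ^ 2 * (2 * b * (b - a)) := by gcongr
    _ = (2 * b - a * 2) * b ^ 3 := by ring

theorem sum_inv_sqrt_add_one_pow_three_le (K : ℕ) :
    ∑ k ∈ Finset.range K, (√((k : ℝ) + 1) ^ 3)⁻¹ ≤ 3 := by
  rcases K with _ | n
  · norm_num
  have htail : ∑ k ∈ Finset.range n, (√((k : ℝ) + 1 + 1) ^ 3)⁻¹ ≤ 2 :=
    calc ∑ k ∈ Finset.range n, (√((k : ℝ) + 1 + 1) ^ 3)⁻¹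
        ≤ ∑ k ∈ Finset.range n, (2 / √((k : ℝ) + 1) - 2 / √(((k + 1 : ℕ) : ℝ) + 1)) :=
          Finset.sum_le_sum fun k _ => by
            push_cast
            exact inv_sqrt_add_one_pow_three_le (by positivity)
      _ = 2 / √((0 : ℕ) + 1) - 2 / √((n : ℝ) + 1) := Finset.sum_range_sub' _ n
      _ ≤ 2 := by
          rw [Nat.cast_zero, zero_add, Real.sqrt_one, div_one]
          exact sub_le_self _ (by positivity)
  rw [Finset.sum_range_succ']
  push_cast
  rw [zero_add, Real.sqrt_one]
  linarith

end Accuracy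

section KrasnoselskiiMann

theorem norm_add_sq_le_one_add_mul_add {E : Type*} [SeminormedAddCommGroup E] (x y : E)
    {t : ℝ} (ht : 0 < t) :
    ‖x + y‖ ^ 2 ≤ (1 + t) * ‖x‖ ^ 2 + (1 + t⁻¹) * ‖y‖ ^ 2 := by
  have hyoung : 2 * (‖x‖ * ‖y‖) ≤ t * ‖x‖ ^ 2 + t⁻¹ * ‖y‖ ^ 2 := by
    have hsq : t⁻¹ * (t * ‖x‖ - ‖y‖) ^ 2
        = t * ‖x‖ ^ 2 - 2 * (‖x‖ * ‖y‖) + t⁻¹ * ‖y‖ ^ 2 := by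
      field_simp
      ring
    linarith [mul_nonneg (inv_nonneg.2 ht.le) (sq_nonneg (t * ‖x‖ - ‖y‖))]
  calc ‖x + y‖ ^ 2 ≤ (‖x‖ + ‖y‖) ^ 2 := by gcongr; exact norm_add_le x y
    _ ≤ (1 + t) * ‖x‖ ^ 2 + (1 + t⁻¹) * ‖y‖ ^ 2 := by linarith

variable {E : Type*} [NormedAddCommGroup E] [InnerProductSpace ℝ E]

theorem IsWeakMVISolution.one_sub_div_mul_norm_sub_sq_le_inner {A : E → Set E} {ρ η : ℝ}
    {xs x p : E} (hxs : IsWeakMVISolution ρ A xs) (hη : 0 < η)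
    (hp : p ∈ resolventOp (smulOp η A) x) :
    (1 - ρ / η) * ‖x - p‖ ^ 2 ≤ inner ℝ (x - p) (x - xs) := by
  obtain ⟨_, ⟨u, hu, rfl⟩, rfl⟩ := hp
  rw [add_sub_cancel_left, add_sub_right_comm, inner_add_right, real_inner_self_eq_norm_sq,
    real_inner_smul_left, norm_smul, Real.norm_of_nonneg hη.le]
  calc (1 - ρ / η) * (η * ‖u‖) ^ 2 = η * (-ρ * ‖u‖ ^ 2) + (η * ‖u‖) ^ 2 := by field_simp; ring
    _ ≤ η * inner ℝ u (p - xs) + (η * ‖u‖) ^ 2 := by gcongr; exact hxs.2 p u hu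

theorem norm_sub_smul_add_smul_sq_add_le {u r e : E} {α ε : ℝ} (hα : 0 ≤ α) (hε : 0 < ε)
    (hr : α * ‖r‖ ^ 2 ≤ inner ℝ r u) (he : ‖e‖ ^ 2 ≤ ε * ‖r‖ ^ 2) :
    ‖u - α • r + α • e‖ ^ 2 + α ^ 2 * ‖r‖ ^ 2 / 2 ≤ (1 + 2 * ε) * ‖u‖ ^ 2 := by
  have hexact : ‖u - α • r‖ ^ 2 ≤ ‖u‖ ^ 2 - α ^ 2 * ‖r‖ ^ 2 := by
    rw [norm_sub_sq_real, real_inner_smul_right, real_inner_comm, norm_smul, mul_pow,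
      Real.norm_of_nonneg hα]
    linarith [mul_le_mul_of_nonneg_left hr hα]
  have herror : ‖α • e‖ ^ 2 ≤ ε * (α ^ 2 * ‖r‖ ^ 2) := by
    rw [norm_smul, mul_pow, Real.norm_of_nonneg hα, mul_left_comm]
    gcongr
  have hyoung := norm_add_sq_le_one_add_mul_add (u - α • r) (α • e) (mul_pos two_pos hε)
  have hcoeff : (1 + (2 * ε)⁻¹) * (ε * (α ^ 2 * ‖r‖ ^ 2)) = (ε + 1 / 2) * (α ^ 2 * ‖r‖ ^ 2) := by
    field_simp
  calc _ ≤ (1 + 2 * ε) * (‖u‖ ^ 2 - α ^ 2 * ‖r‖ ^ 2)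
          + (1 + (2 * ε)⁻¹) * (ε * (α ^ 2 * ‖r‖ ^ 2)) + α ^ 2 * ‖r‖ ^ 2 / 2 := by
        grw [hyoung, hexact, herror]
    _ = (1 + 2 * ε) * ‖u‖ ^ 2 - ε * (α ^ 2 * ‖r‖ ^ 2) := by rw [hcoeff]; ring
    _ ≤ (1 + 2 * ε) * ‖u‖ ^ 2 := sub_le_self _ (by positivity)

theorem add_sum_le_exp_sum_mul_of_quasiFejer {D s ε : ℕ → ℝ} (hD : 0 ≤ D 0)
    (hs : ∀ k, 0 ≤ s k) (hε : ∀ k, 0 ≤ ε k) (h : ∀ k, D (k + 1) + s k ≤ (1 + ε k) * D k)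
    (K : ℕ) :
    D K + ∑ k ∈ Finset.range K, s k ≤ Real.exp (∑ k ∈ Finset.range K, ε k) * D 0 := by
  induction K with
  | zero => simp
  | succ K ih =>
    rw [Finset.sum_range_succ, Finset.sum_range_succ, add_comm (∑ k ∈ Finset.range K, ε k),
      Real.exp_add, mul_assoc]
    have hS : 0 ≤ ∑ k ∈ Finset.range K, s k := Finset.sum_nonneg fun k _ => hs k
    have hεK := hε K
    calc D (K + 1) + (∑ k ∈ Finset.range K, s k + s K)
        ≤ (1 + ε K) * (D K + ∑ k ∈ Finset.range K, s k) := by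
          linarith [h K, mul_nonneg hεK hS]
      _ ≤ (1 + ε K) * (Real.exp (∑ k ∈ Finset.range K, ε k) * D 0) := by gcongr
      _ ≤ Real.exp (ε K) * (Real.exp (∑ k ∈ Finset.range K, ε k) * D 0) := by
          gcongr
          linarith [Real.add_one_le_exp (ε K)]

theorem sq_mul_sum_norm_sub_sq_le_exp_mul {x z p : ℕ → E} {xs : E} {α : ℝ} {ε : ℕ → ℝ}
    (hα : 0 ≤ α) (hε : ∀ k, 0 < ε k) (hx : ∀ k, x (k + 1) = (1 - α) • x k + α • z k)
    (hp : ∀ k, α * ‖x k - p k‖ ^ 2 ≤ inner ℝ (x k - p k) (x k - xs))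
    (hz : ∀ k, ‖z k - p k‖ ^ 2 ≤ ε k * ‖x k - p k‖ ^ 2) (K : ℕ) :
    α ^ 2 * ∑ k ∈ Finset.range K, ‖x k - p k‖ ^ 2
      ≤ 2 * Real.exp (2 * ∑ k ∈ Finset.range K, ε k) * ‖x 0 - xs‖ ^ 2 := by
  have hstep (k : ℕ) : ‖x (k + 1) - xs‖ ^ 2 + α ^ 2 * ‖x k - p k‖ ^ 2 / 2
      ≤ (1 + 2 * ε k) * ‖x k - xs‖ ^ 2 := by
    convert norm_sub_smul_add_smul_sq_add_le hα (hε k) (hp k) (hz k) using 4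
    rw [hx]
    module
  have hsum := add_sum_le_exp_sum_mul_of_quasiFejer (D := fun k => ‖x k - xs‖ ^ 2)
    (sq_nonneg _) (fun k => by positivity) (fun k => mul_nonneg two_pos.le (hε k).le) hstep K
  rw [← Finset.sum_div, ← Finset.mul_sum, ← Finset.mul_sum] at hsum
  linarith [sq_nonneg ‖x K - xs‖]

end KrasnoselskiiMann

section Algorithm

variable {E : Type} [NormedAddCommGroup E] [InnerProductSpace ℝ E]
  {F : E → E} {G : E → Set E} {L : ℝ≥0} {ρ η : ℝ}

theorem norm_run_approxResolvent_sub_sq_le (hF : LipschitzWith L F) (hG : IsMonotoneOp G)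
    {oR : ℝ → E → E} (hR : ∀ γ, 0 < γ → ∀ v, oR γ v ∈ resolventOp (smulOp γ G) v)
    (hη : 0 < η) (hηL : η * L < 1) {x p : E} (hp : p ∈ resolventOp (smulOp η (addOp F G)) x)
    (k : ℕ) :
    ‖(approxResolvent η L k x).run F oR - p‖ ^ 2
      ≤ (6 * √((k : ℝ) + 1) ^ 3)⁻¹ * ‖x - p‖ ^ 2 := by
  lift η to ℝ≥0 using hη.le
  have hR' (v : E) : oR (1 / (2 * (1 + (η * L : ℝ≥0))) * η) v
      ∈ resolventOp (smulOp (1 / (2 * (1 + (η * L : ℝ≥0)))) (smulOp η G)) v := by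
    rw [smulOp_smulOp]
    exact hR _ (by positivity) v
  rw [smulOp_addOp] at hp
  have hfbf := norm_iterate_fbfStep_sub_sq_le (hG.smul hη.le) (lipschitzWith_mul_smul hF)
    (mod_cast hηL.le) hR' hp x (innerIters η L k)
  rw [NNReal.coe_mul] at hfbf
  rw [run_approxResolvent]
  grw [hfbf, one_sub_pow_innerIters_le (by positivity) hηL]

theorem kmIterate_succ (F : E → E) (G : E → Set E) (η L ρ : ℝ) (x₀ : E) (k : ℕ) :
    kmIterate F G η L ρ x₀ (k + 1) = (1 - (1 - ρ / η)) • kmIterate F G η L ρ x₀ k +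
      (1 - ρ / η) •
        (approxResolvent η L k (kmIterate F G η L ρ x₀ k)).run F (resOracle G) := by
  simp only [kmIterate, kmStep, Prog.run_bind, Prog.run]

theorem sq_mul_sum_norm_kmIterate_sub_J_sq_le {xs : E} (hF : LipschitzWith L F)
    (hG : IsMonotoneOp G) (hJG : ∀ γ : ℝ, 0 < γ → HasSingleValuedResolvent (smulOp γ G))
    (hJ : HasSingleValuedResolvent (smulOp η (addOp F G))) (hη : 0 < η) (hρη : ρ ≤ η)
    (hηL : η * L < 1) (hxs : IsWeakMVISolution ρ (addOp F G) xs) (x₀ : E) (K : ℕ) :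
    (1 - ρ / η) ^ 2 * ∑ k ∈ Finset.range K,
        ‖kmIterate F G η L ρ x₀ k - J (smulOp η (addOp F G)) (kmIterate F G η L ρ x₀ k)‖ ^ 2
      ≤ 11 * ‖x₀ - xs‖ ^ 2 := by
  have hα : 0 ≤ 1 - ρ / η := sub_nonneg.2 ((div_le_one hη).2 hρη)
  have herrors : 2 * ∑ k ∈ Finset.range K, (6 * √((k : ℝ) + 1) ^ 3)⁻¹ ≤ 1 := by
    simp only [mul_inv, ← Finset.mul_sum]
    linarith [sum_inv_sqrt_add_one_pow_three_le K]
  have hexp : 2 * Real.exp (2 * ∑ k ∈ Finset.range K, (6 * √((k : ℝ) + 1) ^ 3)⁻¹) ≤ 11 := by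
    linarith [Real.exp_le_exp.2 herrors, Real.exp_one_lt_d9]
  grw [← hexp]
  exact sq_mul_sum_norm_sub_sq_le_exp_mul hα (fun k => by positivity)
    (kmIterate_succ F G η L ρ x₀)
    (fun k => hxs.one_sub_div_mul_norm_sub_sq_le_inner hη (hJ.J_mem _))
    (fun k => norm_run_approxResolvent_sub_sq_le hF hG (fun γ hγ => (hJG γ hγ).J_mem) hη hηL
      (hJ.J_mem _) k) K

end Algorithm

end WeakMVI

theorem theorem2_general {E : Type} [NormedAddCommGroup E] [InnerProductSpace ℝ E]
    [CompleteSpace E] (L : ℝ≥0) (F : E → E) (G : E → Set E) (hF : LipschitzWith L F)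
    (hG : WeakMVI.IsMaximalMonotoneOp G) (ρ η : ℝ) (hη : 0 < η) (hρη : ρ < η)
    (hηL : η * L < 1) (xs : E) (hxs : WeakMVI.IsWeakMVISolution ρ (WeakMVI.addOp F G) xs)
    (x₀ : E) :
    (∀ γ : ℝ, 0 < γ → WeakMVI.HasSingleValuedResolvent (WeakMVI.smulOp γ G)) ∧
    WeakMVI.HasSingleValuedResolvent (WeakMVI.smulOp η (WeakMVI.addOp F G)) ∧
    (∀ K : ℕ, 1 ≤ K →
      1 / (K : ℝ) * ∑ k ∈ Finset.range K, 1 / η ^ 2 *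
          ‖WeakMVI.kmIterate F G η L ρ x₀ k
            - WeakMVI.J (WeakMVI.smulOp η (WeakMVI.addOp F G))
                (WeakMVI.kmIterate F G η L ρ x₀ k)‖ ^ 2
        ≤ 11 * ‖x₀ - xs‖ ^ 2 / ((η - ρ) ^ 2 * K)) ∧
    (∀ k : ℕ, WeakMVI.kmCalls F G η L ρ x₀ k ≤ 2 * WeakMVI.innerIters η L k) := by
  have hJG (γ : ℝ) (hγ : 0 < γ) := (hG.smul hγ).hasSingleValuedResolvent
  have hJ := hG.hasSingleValuedResolvent_smulOp_addOp hF hη hηL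
  refine ⟨hJG, hJ, fun K hK => ?_, fun k => (WeakMVI.oracleCalls_kmStep F _ η L ρ k _).le⟩
  have hbound :=
    WeakMVI.sq_mul_sum_norm_kmIterate_sub_J_sq_le hF hG.1 hJG hJ hη hρη.le hηL hxs x₀ K
  have hρη_pos : 0 < η - ρ := sub_pos.2 hρη
  rw [← Finset.mul_sum, le_div_iff₀ (by positivity)]
  refine le_of_eq_of_le ?_ hbound
  field_simp

theorem theorem2 {d : ℕ} (L : ℝ≥0)
    (F : EuclideanSpace ℝ (Fin d) → EuclideanSpace ℝ (Fin d))
    (G : EuclideanSpace ℝ (Fin d) → Set (EuclideanSpace ℝ (Fin d)))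
    (hF : LipschitzWith L F) (hG : WeakMVI.IsMaximalMonotoneOp G)
    (ρ η : ℝ) (hρ : 0 < ρ) (hρη : ρ < η) (hηL : η * L < 1)
    (xs : EuclideanSpace ℝ (Fin d))
    (hxs : WeakMVI.IsWeakMVISolution ρ (WeakMVI.addOp F G) xs)
    (x₀ : EuclideanSpace ℝ (Fin d)) :
    -- the resolvents that the algorithm evaluates and the one in the bound are well defined
    (∀ γ : ℝ, 0 < γ → WeakMVI.HasSingleValuedResolvent (WeakMVI.smulOp γ G)) ∧
    WeakMVI.HasSingleValuedResolvent (WeakMVI.smulOp η (WeakMVI.addOp F G)) ∧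
    -- the bound on the average squared residual
    (∀ K : ℕ, 1 ≤ K →
      1 / (K : ℝ) * ∑ k ∈ Finset.range K, 1 / η ^ 2 *
          ‖WeakMVI.kmIterate F G η L ρ x₀ k
            - WeakMVI.J (WeakMVI.smulOp η (WeakMVI.addOp F G))
                (WeakMVI.kmIterate F G η L ρ x₀ k)‖ ^ 2
        ≤ 11 * ‖x₀ - xs‖ ^ 2 / ((η - ρ) ^ 2 * K)) ∧
    -- the cost of iteration `k`
    (∀ k : ℕ, WeakMVI.kmCalls F G η L ρ x₀ k ≤ 2 * WeakMVI.innerIters η L k) :=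
  theorem2_general L F G hF hG ρ η (hρ.trans hρη) hρη hηL xs hxs x₀
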